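/- Fix $p,q,C,\lambda\in\mathbb R$ with $0<2p<q<1$ and $C>0$, and consider the following controlled Markov chain on $\mathbb N=\{0,1,2,\dots\}$ (a single processor-sharing queue): $$X_{t+1}=X_t-D_{t+1}+\nu_t\xi_{t+1},$$ where, given the past up to time $t$ and the control $\nu_t\in\{0,1\}$, the departures $D_{t+1}$ and the arrival $\xi_{t+1}$ are independent, $\xi_{t+1}$ is Bernoulli($p$) and $D_{t+1}$ is binomial with parameters $X_t$ and $q/X_t$ (no departures if $X_t=0$). A control $\{\nu_t\}$ is admissible if $\nu_t$ is chosen, possibly with randomization, on the basis of $X_0$ and $(\nu_s,D_{s+1},\xi_{s+1})_{s<t}$ only. The running cost is $c(x,\nu)=Cx+(1-\nu)\lambda$. For $0<\alpha<1$ let $$V_\alpha(x)=\inf_{\{\nu_t\}\ \text{admissible}} E\Big[\sum_{t=0}^{\infty}\alpha^t c(X_t,\nu_t)\,\Big|\,X_0=x\Big].$$ Then for every $x\in\mathbb N$ the limit $V(x)=\lim_{\alpha\uparrow1}\big(V_\alpha(x)-V_\alpha(0)\big)$ exists (this $V$ is the average-cost value function), the limit $\beta=\lim_{\alpha\uparrow1}(1-\alpha)V_\alpha(0)$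 exists, and $(V,\beta)$ solves the average-cost dynamic programming equation $$V(x)=Cx-\beta+\min\Big(\sum_{d=0}^{x}b_x(d)\big(pV(x+1-d)+(1-p)V(x-d)\big),\ \lambda+\sum_{d=0}^{x}b_x(d)V(x-d)\Big),\qquad x\in\mathbb N,$$ where $b_x(d)=\binom xd\big(\tfrac qx\big)^d\big(1-\tfrac qx\big)^{x-d}$ for $x\ge1$ and $b_0(0)=1$. Moreover $V$ has increasing differences: for all $x,y,z\in\mathbb N$, $$z>0,\ x>y\quad\Longrightarrow\quad V(x+z)-V(x)\ \ge\ V(y+z)-V(y).$$ -/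

import Mathlib

open Filter Topology

noncomputable section

namespace ProcessorSharing

/-- What happens in one time slot: the control `ν_t` (`true` = active), the number of departures
`D_{t+1}`, and whether there is an arrival (`true` means `ξ_{t+1} = 1`). -/
abbrev Slot : Type := Bool × ℕ × Bool

/-- The slots observed up to the current time, the most recent one first. -/
abbrev History : Type := List Slot

/-- The queue length reached from the initial queue length `x₀` after the history `h`, by the
dynamics `X_{t+1} = X_t - D_{t+1} + ν_t ξ_{t+1}`. -/
def state (x₀ : ℕ) : History → ℕ
  | [] => x₀
  | (ν, d, ξ) :: h => state x₀ h - d + if ν && ξ then 1 else 0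

/-- An admissible control: given the past, a (possibly degenerate) probability with which the next
control is active. The control may use the whole past and additional randomization, but it does not
see the departures and arrivals to come. -/
abbrev Control : Type := History → Set.Icc (0 : ℝ) 1

/-- Conditional probability that the control equals `ν`, given the history `h`. -/
def controlProb (π : Control) (h : History) (ν : Bool) : ℝ :=
  if ν then (π h : ℝ) else 1 - (π h : ℝ)

/-- Binomial probability of `d` departures when `x` jobs are in the server; each of the jobs departs
with probability `q / x`. For `x = 0` there is no departure. -/
def departureProb (q : ℝ) (x d : ℕ) : ℝ :=
  (x.choose d : ℝ) * (q / x) ^ d * (1 - q / x) ^ (x - d)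

/-- Bernoulli arrival probabilities. -/
def arrivalProb (p : ℝ) (ξ : Bool) : ℝ := if ξ then p else 1 - p

/-- Expectation of a function of the history of the first `t` slots under the law that the control
`π` induces for the initial queue length `x₀`: given the past `h`, the control is drawn from
`controlProb π h`, and, independently of it, the departures are binomial with parameters given by
the current queue length and the arrival is Bernoulli. -/
def expect (p q : ℝ) (π : Control) (x₀ : ℕ) : ℕ → (History → ℝ) → ℝ
  | 0, f => f []
  | t + 1, f => expect p q π x₀ t fun h =>
      ∑ ν : Bool, ∑ d ∈ Finset.range (state x₀ h + 1), ∑ ξ : Bool,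
        controlProb π h ν * departureProb q (state x₀ h) d * arrivalProb p ξ * f ((ν, d, ξ) :: h)

/-- The running cost `c(x, ν) = C x + (1 - ν) lam`. -/
def runningCost (C lam : ℝ) (x : ℕ) (ν : Bool) : ℝ := C * x + if ν then 0 else lam

/-- The expected cost `E[c(X_t, ν_t) | X_0 = x₀]` of time slot `t`. -/
def expectedCost (p q C lam : ℝ) (π : Control) (x₀ t : ℕ) : ℝ :=
  expect p q π x₀ t fun h => ∑ ν : Bool, controlProb π h ν * runningCost C lam (state x₀ h) ν

/-- The infinite horizon `α`-discounted cost of the control `π`. -/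
def discountedCost (p q C lam α : ℝ) (π : Control) (x₀ : ℕ) : ℝ :=
  ∑' t : ℕ, α ^ t * expectedCost p q C lam π x₀ t

/-- The `α`-discounted value function `V_α`, the infimum of the cost over all admissible controls. -/
def discountedValue (p q C lam α : ℝ) (x : ℕ) : ℝ :=
  ⨅ π : Control, discountedCost p q C lam α π x

/-- The relative discounted value function `V_α - V_α 0`. -/
def relativeValue (p q C lam α : ℝ) (x : ℕ) : ℝ :=
  discountedValue p q C lam α x - discountedValue p q C lam α 0

/-- The average-cost value function, the vanishing-discount limit of `V_α - V_α 0` as `α ↑ 1`. -/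
def averageCostValue (p q C lam : ℝ) (x : ℕ) : ℝ :=
  limUnder (𝓝[<] (1 : ℝ)) fun α => relativeValue p q C lam α x

/-- The average-cost dynamic programming equation for a pair `(V, β)`. -/
def SolvesAverageCostDP (p q C lam : ℝ) (V : ℕ → ℝ) (β : ℝ) : Prop :=
  ∀ x : ℕ, V x = C * x - β +
    min (∑ d ∈ Finset.range (x + 1), departureProb q x d * (p * V (x + 1 - d) + (1 - p) * V (x - d)))
      (lam + ∑ d ∈ Finset.range (x + 1), departureProb q x d * V (x - d))

end ProcessorSharing

end

/-!
The proof approaches the average-cost problem by vanishing discount.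

*Convexity.* For a discount factor `α < 1`, value iteration produces a solution of the discounted
dynamic programming equation of linear growth (`exists_discounted_solution`), and a verification
argument identifies it with the infimum of the discounted cost over all history-dependent randomized
controls (`discountedValue_eq`). The dynamic programming operator preserves the increasing functions
with increasing differences (`IncreasingConvex.bellman`). The point is that the number of jobs that
survive a slot is binomial with parameters `x` and `1 - q / x`, so one more job also changes the
success probability. Binomial means are polynomials in the success probability, convex when the
function is, and lie above their tangents (`binMean_tangent_le`). Replacing the success
probabilities for `x` and `x + 2` jobs by the one for `x + 1` jobs costs two tangent terms whose
coefficients agree, and what remains is nonnegative. To absorb the nonconvex minimum over the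
controls, a likelihood ratio bound (`binMean_le_pow_mul`) and `(1 + 1 / n) ^ n ≤ 3` are used
together with `p ≤ 1 / 2`; see `mul_serviceMean_fwdDiff_sub_le`.

*Stability.* For `r = 3 / 2` and `r = 2` the function `r ^ x` has negative drift away from the empty
queue, uniformly over the controls (`step_pow_le`); for `r = 2` this is the condition `2 * p < q`.
Hence a function of growth at most `(3 / 2) ^ x` that is subharmonic away from `0` is maximal at `0`
(`le_apply_zero_of_le_step`). This maximum principle bounds the relative values `V_α x - V_α 0` by
`K * (3 / 2) ^ x` uniformly in `α` (`exists_relativeValue_le`), and it shows that the average-cost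
equation has at most one normalized solution within that bound (`IsAverageSolution.unique`).

*Limit.* The relative values and `(1 - α) * V_α 0` stay in a compact set, and each of their cluster
points as `α ↑ 1` solves the average-cost equation. As the solution is unique, they converge
(`exists_isAverageSolution_tendsto`), and convexity passes to the limit.
-/

noncomputable section

namespace ProcessorSharing

/-! ### Binomial means -/

/-- The mean of `f` under the binomial law with parameters `n` and `u`, by conditioning on one of
the `n` trials. -/
def binMean (u : ℝ) : ℕ → (ℕ → ℝ) → ℝ
  | 0, f => f 0
  | n + 1, f => (1 - u) * binMean u n f + u * binMean u n fun j => f (j + 1)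

theorem binMean_add (u : ℝ) (n : ℕ) (f g : ℕ → ℝ) :
    binMean u n (fun j => f j + g j) = binMean u n f + binMean u n g := by
  induction n generalizing f g with
  | zero => rfl
  | succ n ih => simp only [binMean, ih]; ring

theorem binMean_const_mul (u c : ℝ) (n : ℕ) (f : ℕ → ℝ) :
    binMean u n (fun j => c * f j) = c * binMean u n f := by
  induction n generalizing f with
  | zero => rfl
  | succ n ih => simp only [binMean, ih]; ring

theorem binMean_sub (u : ℝ) (n : ℕ) (f g : ℕ → ℝ) :
    binMean u n (fun j => f j - g j) = binMean u n f - binMean u n g := by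
  induction n generalizing f g with
  | zero => rfl
  | succ n ih => simp only [binMean, ih]; ring

theorem binMean_const (u c : ℝ) (n : ℕ) : binMean u n (fun _ => c) = c := by
  induction n with
  | zero => rfl
  | succ n ih => simp only [binMean, ih]; ring

theorem binMean_pow (u r : ℝ) (n : ℕ) :
    binMean u n (fun j => r ^ j) = (1 - u + u * r) ^ n := by
  induction n with
  | zero => simp [binMean]
  | succ n ih =>
    have h : (fun j : ℕ => r ^ (j + 1)) = fun j => r * r ^ j := by funext j; ring
    rw [binMean, h, binMean_const_mul, ih]; ring

theorem binMean_mono {u : ℝ} (hu : u ∈ Set.Icc (0 : ℝ) 1) {n : ℕ} {f g : ℕ → ℝ}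
    (h : ∀ j ≤ n, f j ≤ g j) : binMean u n f ≤ binMean u n g := by
  induction n generalizing f g with
  | zero => exact h 0 le_rfl
  | succ n ih =>
    have h₁ := ih fun j hj => h j (by omega)
    have h₂ := ih (f := fun j => f (j + 1)) (g := fun j => g (j + 1)) fun j hj => h _ (by omega)
    have := mul_le_mul_of_nonneg_left h₁ (sub_nonneg.2 hu.2)
    have := mul_le_mul_of_nonneg_left h₂ hu.1
    simp only [binMean]; linarith

theorem binMean_nonneg {u : ℝ} (hu : u ∈ Set.Icc (0 : ℝ) 1) {n : ℕ} {f : ℕ → ℝ}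
    (h : ∀ j, 0 ≤ f j) : 0 ≤ binMean u n f := by
  simpa [binMean_const] using binMean_mono hu (n := n) (f := fun _ => 0) fun j _ => h j

/-- One more trial adds `u` times the mean of the forward difference. -/
theorem binMean_succ (u : ℝ) (n : ℕ) (f : ℕ → ℝ) :
    binMean u (n + 1) f = binMean u n f + u * binMean u n (fwdDiff 1 f) := by
  have : fwdDiff 1 f = fun j => f (j + 1) - f j := rfl
  rw [binMean, this, binMean_sub]; ring

theorem binMean_eq_sum (u : ℝ) (n : ℕ) (f : ℕ → ℝ) :
    binMean u n f
      = ∑ j ∈ Finset.range (n + 1), (n.choose j : ℝ) * u ^ j * (1 - u) ^ (n - j) * f j := by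
  induction n generalizing f with
  | zero => simp [binMean]
  | succ n ih =>
    rw [binMean, ih, ih, Finset.sum_range_succ' _ (n + 1)]
    have h₁ : ∀ j ∈ Finset.range (n + 1),
        ((n + 1).choose (j + 1) : ℝ) * u ^ (j + 1) * (1 - u) ^ (n + 1 - (j + 1)) * f (j + 1)
          = u * ((n.choose j : ℝ) * u ^ j * (1 - u) ^ (n - j) * f (j + 1))
            + (n.choose (j + 1) : ℝ) * u ^ (j + 1) * (1 - u) ^ (n - j) * f (j + 1) := by
      intro j _
      rw [Nat.choose_succ_succ, Nat.add_sub_add_right]; push_cast; ring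
    rw [Finset.sum_congr rfl h₁, Finset.sum_add_distrib, ← Finset.mul_sum,
      Finset.sum_range_succ (fun j => (n.choose (j + 1) : ℝ) * u ^ (j + 1) * _ * _) n,
      Finset.sum_range_succ' _ n, Nat.choose_succ_self]
    have h₂ : ∀ j ∈ Finset.range n,
        (n.choose (j + 1) : ℝ) * u ^ (j + 1) * (1 - u) ^ (n - j) * f (j + 1)
          = (1 - u) * ((n.choose (j + 1) : ℝ) * u ^ (j + 1) * (1 - u) ^ (n - (j + 1))
            * f (j + 1)) := by
      intro j hj
      have := Finset.mem_range.1 hj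
      rw [show n - j = n - (j + 1) + 1 by omega]; ring
    rw [Finset.sum_congr rfl h₂, ← Finset.mul_sum]
    simp; ring

theorem binMean_fwdDiff_nonneg {u : ℝ} (hu : u ∈ Set.Icc (0 : ℝ) 1) {n : ℕ} {f : ℕ → ℝ}
    (hf : Monotone f) : 0 ≤ binMean u n (fwdDiff 1 f) :=
  binMean_nonneg hu fun j => sub_nonneg.2 (hf (Nat.le_succ j))

/-- The binomial mean of a convex function is convex in the success probability: its graph lies
above its tangents. -/
theorem binMean_tangent_le {u v : ℝ} (hu : u ∈ Set.Icc (0 : ℝ) 1) (hv : v ∈ Set.Icc (0 : ℝ) 1)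
    (n : ℕ) {f : ℕ → ℝ} (hf : Monotone (fwdDiff 1 f)) :
    binMean u n f + (v - u) * (n * binMean u (n - 1) (fwdDiff 1 f)) ≤ binMean v n f := by
  induction n generalizing f with
  | zero => simp [binMean]
  | succ n ih =>
    have hf' : Monotone (fwdDiff 1 fun j => f (j + 1)) := fun a b hab => hf (Nat.succ_le_succ hab)
    have h₁ := mul_le_mul_of_nonneg_left (ih hf) (sub_nonneg.2 hv.2)
    have h₂ := mul_le_mul_of_nonneg_left (ih hf') hv.1
    have e₁ : binMean u n (fun j => f (j + 1))
        = binMean u n f + binMean u n (fwdDiff 1 f) := by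
      rw [← binMean_add]; congr 1; funext j; simp [fwdDiff]
    have e₂ : binMean u (n - 1) (fwdDiff 1 fun j => f (j + 1))
        = binMean u (n - 1) (fwdDiff 1 f) + binMean u (n - 1) (fwdDiff 1 (fwdDiff 1 f)) := by
      rw [← binMean_add]; congr 1; funext j; simp [fwdDiff]
    have h₃ := binMean_fwdDiff_nonneg hu (n := n - 1) hf
    have e₃ : (n : ℝ) * binMean u n (fwdDiff 1 f) = n * (binMean u (n - 1) (fwdDiff 1 f)
        + u * binMean u (n - 1) (fwdDiff 1 (fwdDiff 1 f))) := by
      rcases n with _ | n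
      · simp
      · rw [binMean_succ]; simp
    have h₄ : 0 ≤ (v - u) ^ 2 * (n * binMean u (n - 1) (fwdDiff 1 (fwdDiff 1 f))) := by positivity
    rw [e₁, e₂] at h₂
    rw [binMean_succ u, binMean]
    simp only [Nat.add_sub_cancel, Nat.cast_add, Nat.cast_one]
    linear_combination h₁ + h₂ + h₄ + (v - u) * e₃

/-- A bound on the likelihood ratio of two binomial laws with the same number of trials. -/
theorem binMean_le_pow_mul {u v κ : ℝ} (hu : u ∈ Set.Icc (0 : ℝ) 1) (hv : v ∈ Set.Icc (0 : ℝ) 1)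
    (huv : u ≤ v) (hκ : 1 ≤ κ) (h : 1 - u ≤ κ * (1 - v)) (n : ℕ) {f : ℕ → ℝ} (hf : ∀ j, 0 ≤ f j) :
    binMean u n f ≤ κ ^ n * binMean v n f := by
  induction n generalizing f with
  | zero => simp [binMean]
  | succ n ih =>
    have h₀ := binMean_nonneg hv (n := n) hf
    have h₀' := binMean_nonneg hv (n := n) (f := fun j => f (j + 1)) fun j => hf _
    have h₁ := mul_le_mul h (ih hf) (binMean_nonneg hu hf) ((sub_nonneg.2 hu.2).trans h)
    have h₂ := mul_le_mul (huv.trans (le_mul_of_one_le_left hv.1 hκ))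
      (ih (f := fun j => f (j + 1)) fun j => hf _) (binMean_nonneg hu fun j => hf _)
      (mul_nonneg (zero_le_one.trans hκ) hv.1)
    rw [binMean, binMean]
    linear_combination h₁ + h₂

/-- Changing the success probability from `u` to `v` one trial at a time changes the mean by terms in
which the trials mix the two probabilities; the likelihood ratio bound reduces them all to `v`. -/
theorem binMean_sub_le {u v κ : ℝ} (hu : u ∈ Set.Icc (0 : ℝ) 1) (hv : v ∈ Set.Icc (0 : ℝ) 1)
    (huv : u ≤ v) (hκ : 1 ≤ κ) (h : 1 - u ≤ κ * (1 - v)) (n : ℕ) {f : ℕ → ℝ} (hf : Monotone f) :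
    binMean v (n + 1) f - binMean u (n + 1) f
      ≤ (v - u) * ((n + 1) * κ ^ n * binMean v n (fwdDiff 1 f)) := by
  have hd : ∀ j, 0 ≤ fwdDiff 1 f j := fun j => sub_nonneg.2 (hf (Nat.le_succ j))
  induction n generalizing f with
  | zero =>
    have h₀ : binMean v (0 + 1) f - binMean u (0 + 1) f = (v - u) * fwdDiff 1 f 0 := by
      simp only [binMean, fwdDiff]; ring
    rw [h₀]; simp [binMean]
  | succ n ih =>
    have hf' : Monotone fun j => f (j + 1) := fun a b hab => hf (Nat.succ_le_succ hab)
    have h₁ := mul_le_mul_of_nonneg_left (ih hf hd) (sub_nonneg.2 hv.2)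
    have h₂ := mul_le_mul_of_nonneg_left (ih hf' fun j => hd (j + 1)) hv.1
    have h₃ := mul_le_mul_of_nonneg_left (binMean_le_pow_mul hu hv huv hκ h (n + 1) hd)
      (sub_nonneg.2 huv)
    have e₁ : binMean v (n + 1) (fwdDiff 1 f) = (1 - v) * binMean v n (fwdDiff 1 f)
        + v * binMean v n (fwdDiff 1 fun j => f (j + 1)) := rfl
    have e₂ : binMean u (n + 1) (fun j => f (j + 1))
        = binMean u (n + 1) f + binMean u (n + 1) (fwdDiff 1 f) := by
      rw [← binMean_add]; congr 1; funext j; simp [fwdDiff]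
    have h₄ : 0 ≤ (v - u) * ((n + 1) * (κ ^ n * (κ - 1)) * binMean v (n + 1) (fwdDiff 1 f)) := by
      have := sub_nonneg.2 huv
      have := sub_nonneg.2 hκ
      have := binMean_nonneg hv (n := n + 1) hd
      positivity
    rw [binMean.eq_2 v f (n + 1), binMean.eq_2 u f (n + 1), e₂]
    rw [e₂] at h₂
    push_cast
    linear_combination h₁ + h₂ + h₃ + h₄ - (v - u) * (n + 1) * κ ^ n * e₁

/-! ### The number of jobs that survive a slot -/

/-- The mean of `f` at the number of jobs that survive a time slot begun with `x` jobs; each job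
survives with probability `1 - q / x`. -/
def serviceMean (q : ℝ) (f : ℕ → ℝ) (x : ℕ) : ℝ := binMean (1 - q / x) x f

theorem sum_departureProb_mul (q : ℝ) (f : ℕ → ℝ) (x : ℕ) :
    ∑ d ∈ Finset.range (x + 1), departureProb q x d * f (x - d) = serviceMean q f x := by
  rw [serviceMean, binMean_eq_sum, ← Finset.sum_flip]
  refine Finset.sum_congr rfl fun d hd => ?_
  have hd' : d ≤ x := Nat.lt_succ_iff.1 (Finset.mem_range.1 hd)
  rw [departureProb, Nat.choose_symm hd', Nat.sub_sub_self hd', sub_sub_cancel]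
  ring

theorem survival_mem_Icc {q : ℝ} (hq₀ : 0 ≤ q) (hq : q ≤ 1) (x : ℕ) :
    1 - q / x ∈ Set.Icc (0 : ℝ) 1 := by
  refine ⟨?_, sub_le_self _ (div_nonneg hq₀ (Nat.cast_nonneg x))⟩
  rcases Nat.eq_zero_or_pos x with rfl | hx
  · simp
  · have : (1 : ℝ) ≤ x := by exact_mod_cast hx
    have : q / x ≤ 1 := (div_le_one (by linarith)).2 (by linarith)
    linarith

theorem survival_le_succ {q : ℝ} (hq₀ : 0 ≤ q) {x : ℕ} (hx : x ≠ 0) :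
    1 - q / x ≤ 1 - q / ((x + 1 : ℕ) : ℝ) := by
  have : (0 : ℝ) < x := by exact_mod_cast Nat.pos_of_ne_zero hx
  have : q / ((x + 1 : ℕ) : ℝ) ≤ q / x := by
    push_cast; gcongr; linarith
  linarith

theorem binMean_mono_param {u v : ℝ} (hu : u ∈ Set.Icc (0 : ℝ) 1) (hv : v ∈ Set.Icc (0 : ℝ) 1)
    (huv : u ≤ v) (n : ℕ) {f : ℕ → ℝ} (hf : Monotone f) : binMean u n f ≤ binMean v n f := by
  induction n generalizing f with
  | zero => rfl
  | succ n ih =>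
    have h₁ := mul_le_mul_of_nonneg_left (ih hf) (sub_nonneg.2 hv.2)
    have h₂ := mul_le_mul_of_nonneg_left
      (ih (f := fun j => f (j + 1)) fun a b hab => hf (Nat.succ_le_succ hab)) hv.1
    have h₃ := mul_nonneg (sub_nonneg.2 huv) (sub_nonneg.2
      (binMean_mono hu (n := n) (g := fun j => f (j + 1)) fun j _ => hf (Nat.le_succ j)))
    rw [binMean, binMean]; linear_combination h₁ + h₂ + h₃

theorem serviceMean_monotone {q : ℝ} (hq₀ : 0 ≤ q) (hq : q ≤ 1) {f : ℕ → ℝ} (hf : Monotone f) :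
    Monotone (serviceMean q f) := by
  refine monotone_nat_of_le_succ fun x => ?_
  have hu := survival_mem_Icc hq₀ hq
  have h₁ : serviceMean q f x ≤ binMean (1 - q / ((x + 1 : ℕ) : ℝ)) x f := by
    rcases eq_or_ne x 0 with rfl | hx
    · rfl
    · exact binMean_mono_param (hu x) (hu (x + 1)) (survival_le_succ hq₀ hx) x hf
  refine h₁.trans ?_
  rw [serviceMean, binMean_succ]
  exact le_add_of_nonneg_right (mul_nonneg (hu _).1 (binMean_fwdDiff_nonneg (hu _) hf))

/-- The left side is `(1 + 1 / (n + 1)) ^ (n + 1)`, which is at most `e`. -/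
theorem ratio_pow_le_three (n : ℕ) : (((n : ℝ) + 2) / (n + 1)) ^ (n + 1) ≤ 3 := by
  have h₀ : ((n : ℝ) + 2) / (n + 1) ≤ Real.exp (1 / (n + 1)) := by
    have := Real.add_one_le_exp (1 / ((n : ℝ) + 1))
    have e : ((n : ℝ) + 2) / (n + 1) = 1 / (n + 1) + 1 := by field_simp; ring
    rwa [e]
  calc (((n : ℝ) + 2) / (n + 1)) ^ (n + 1) ≤ Real.exp (1 / (n + 1)) ^ (n + 1) := by gcongr
    _ = Real.exp 1 := by
      rw [← Real.exp_nat_mul]; congr 1; push_cast; field_simp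
    _ ≤ 3 := by have := Real.exp_one_lt_d9; linarith

/-- The second difference of the mean queue cost after service dominates the increment, over one
more job, of the mean marginal cost of an accepted arrival. Passing from `x + 1` to `x` or `x + 2`
jobs changes the survival probability; the tangent inequality at the survival probability for
`x + 1` jobs reduces both neighbours to that probability, and the two tangent corrections carry the
same factor `q / (x + 1)`. -/
theorem mul_serviceMean_fwdDiff_sub_le {p q : ℝ} (hp : 0 ≤ p) (hp' : p ≤ 1 / 2) (hq₀ : 0 ≤ q)
    (hq : q ≤ 1) {f : ℕ → ℝ} (hf : Monotone f) (hf' : Monotone (fwdDiff 1 f)) (x : ℕ) :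
    p * (serviceMean q (fwdDiff 1 f) (x + 1) - serviceMean q (fwdDiff 1 f) x)
      ≤ serviceMean q f (x + 2) - 2 * serviceMean q f (x + 1) + serviceMean q f x := by
  have hu := survival_mem_Icc hq₀ hq
  have hh : ∀ j, 0 ≤ fwdDiff 1 (fwdDiff 1 f) j := fun j => sub_nonneg.2 (hf' (Nat.le_succ j))
  rcases x with _ | n
  · have hg : 0 ≤ fwdDiff 1 f 0 := sub_nonneg.2 (hf (Nat.le_succ 0))
    have h₁ := binMean_tangent_le (hu 1) (hu 2) 2 hf'
    have hX := hh 0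
    simp only [serviceMean, binMean, fwdDiff] at *
    push_cast at *
    simp only [div_one] at *
    have h₂ : 0 ≤ (1 - p) * ((1 - q) * (f 2 - f 1 - (f 1 - f 0))) :=
      mul_nonneg (by linarith) (mul_nonneg (by linarith) hX)
    have h₃ := mul_nonneg hq₀ hg
    norm_num at *
    linear_combination h₁ + h₂ + h₃
  · set s : ℝ := q / ((n : ℝ) + 2) with hs
    have hn : (0 : ℝ) ≤ n := Nat.cast_nonneg n
    have e₀ : 1 - q / ((n + 1 : ℕ) : ℝ) = 1 - q / ((n : ℝ) + 1) := by push_cast; rfl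
    have e₁ : 1 - q / ((n + 1 + 1 : ℕ) : ℝ) = 1 - s := by rw [hs]; push_cast; ring_nf
    have e₂ : 1 - q / ((n + 1 + 2 : ℕ) : ℝ) = 1 - q / ((n : ℝ) + 3) := by push_cast; ring_nf
    have hu₀ := hu (n + 1)
    have hu₁ := hu (n + 1 + 1)
    have hu₂ := hu (n + 1 + 2)
    have h₀₁ := survival_le_succ hq₀ (Nat.succ_ne_zero n)
    have h₁ := binMean_tangent_le hu₁ hu₂ (n + 3) hf'
    have h₂ := binMean_tangent_le hu₁ hu₀ (n + 1) hf'
    have hκ : (1 : ℝ) ≤ (n + 2) / (n + 1) := (one_le_div (by linarith)).2 (by linarith)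
    have hκ' : 1 - (1 - q / ((n + 1 : ℕ) : ℝ))
        ≤ ((n : ℝ) + 2) / (n + 1) * (1 - (1 - q / ((n + 1 + 1 : ℕ) : ℝ))) := by
      rw [e₀, e₁, hs]; refine le_of_eq ?_; field_simp; ring
    have h₃ := binMean_sub_le hu₀ hu₁ h₀₁ hκ hκ' n hf'
    simp only [serviceMean]
    rw [e₁, e₂] at h₁
    rw [e₁, e₀] at h₂ h₃
    rw [e₁, e₂, e₀]
    rw [e₁] at hu₁
    set κ : ℝ := ((n : ℝ) + 2) / (n + 1) with hκdef
    have d₁ : (1 - q / ((n : ℝ) + 3) - (1 - s)) * ((n + 3 : ℕ) : ℝ) = s := by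
      rw [hs]; push_cast; field_simp; ring
    have d₂ : (1 - q / ((n : ℝ) + 1) - (1 - s)) * ((n + 1 : ℕ) : ℝ) = -s := by
      rw [hs]; push_cast; field_simp; ring
    have d₃ : (1 - s - (1 - q / ((n : ℝ) + 1))) * ((n : ℝ) + 1) = s := by
      rw [hs]; field_simp; ring
    rw [← mul_assoc, d₁] at h₁
    rw [← mul_assoc, d₂] at h₂
    rw [← mul_assoc, ← mul_assoc, d₃] at h₃
    simp only [Nat.add_sub_cancel, show n + 3 - 1 = n + 2 by rfl] at h₁ h₂
    set g := fwdDiff 1 f with hg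
    set h := fwdDiff 1 g with hhd
    set Y := binMean (1 - s) n h with hY
    set X := binMean (1 - s) (n + 1) h with hX
    have hs₀ : 0 ≤ s := by positivity
    have hY₀ : 0 ≤ Y := binMean_nonneg hu₁ hh
    have hXY : s * Y ≤ X := by
      have : X = (1 - (1 - s)) * Y + (1 - s) * binMean (1 - s) n fun j => h (j + 1) := rfl
      have := mul_nonneg hu₁.1 (binMean_nonneg hu₁ (n := n) fun j => hh (j + 1))
      linarith
    have r₁ : binMean (1 - s) (n + 3) f = binMean (1 - s) (n + 2) f
        + (1 - s) * binMean (1 - s) (n + 2) g := binMean_succ _ _ _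
    have r₂ : binMean (1 - s) (n + 2) f = binMean (1 - s) (n + 1) f
        + (1 - s) * binMean (1 - s) (n + 1) g := binMean_succ _ _ _
    have r₃ : binMean (1 - s) (n + 2) g = binMean (1 - s) (n + 1) g + (1 - s) * X :=
      binMean_succ _ _ _
    have r₄ : binMean (1 - s) (n + 1) g = binMean (1 - s) n g + (1 - s) * Y := binMean_succ _ _ _
    -- It remains to compare `κ ^ n` with `1 - s ≥ 1 / κ`, which is where `p ≤ 1 / 2` enters.
    have hκn : p * κ ^ n ≤ (1 - s) * (2 - p) := by
      have k₁ : p * κ ^ (n + 1) ≤ 2 - p := by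
        have := mul_le_mul_of_nonneg_left (ratio_pow_le_three n) hp
        linarith
      have k₂ : 1 ≤ κ * (1 - s) := by
        have : κ * (1 - s) - 1 = (1 - q) / (n + 1) := by rw [hκdef, hs]; field_simp; ring
        have : 0 ≤ (1 - q) / ((n : ℝ) + 1) := div_nonneg (by linarith) (by linarith)
        linarith
      have k₃ : 0 ≤ p * κ ^ n := by positivity
      calc p * κ ^ n ≤ p * κ ^ n * (κ * (1 - s)) := le_mul_of_one_le_right k₃ k₂
        _ = (1 - s) * (p * κ ^ (n + 1)) := by ring
        _ ≤ _ := mul_le_mul_of_nonneg_left k₁ hu₁.1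
    have m₁ := mul_le_mul_of_nonneg_right hκn (mul_nonneg hs₀ hY₀)
    have m₂ := mul_le_mul_of_nonneg_left hXY
      (mul_nonneg (show (0 : ℝ) ≤ 1 - p by linarith) hu₁.1)
    have m₃ := mul_le_mul_of_nonneg_left h₃ hp
    clear_value s
    simp only [show n + 1 + 1 = n + 2 from rfl, show n + 1 + 2 = n + 3 from rfl]
    linear_combination h₁ + h₂ + m₁ + m₂ + m₃ - r₁ + r₂ + (p - 1) * r₃ - s * r₄

theorem serviceMean_add (q : ℝ) (f g : ℕ → ℝ) (x : ℕ) :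
    serviceMean q (fun j => f j + g j) x = serviceMean q f x + serviceMean q g x :=
  binMean_add _ _ _ _

theorem serviceMean_const_mul (q c : ℝ) (f : ℕ → ℝ) (x : ℕ) :
    serviceMean q (fun j => c * f j) x = c * serviceMean q f x :=
  binMean_const_mul _ _ _ _

theorem serviceMean_sub (q : ℝ) (f g : ℕ → ℝ) (x : ℕ) :
    serviceMean q (fun j => f j - g j) x = serviceMean q f x - serviceMean q g x :=
  binMean_sub _ _ _ _

theorem serviceMean_const (q c : ℝ) (x : ℕ) : serviceMean q (fun _ => c) x = c :=
  binMean_const _ _ _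

theorem serviceMean_mono {q : ℝ} (hq₀ : 0 ≤ q) (hq : q ≤ 1) {f g : ℕ → ℝ} {x : ℕ}
    (h : ∀ j ≤ x, f j ≤ g j) : serviceMean q f x ≤ serviceMean q g x :=
  binMean_mono (survival_mem_Icc hq₀ hq x) h

/-! ### The dynamic programming operator -/

/-- The mean of `f` at the queue length that follows `x`, if an arrival occurs with probability `a`:
`a = p` for the active control and `a = 0` for the passive one. -/
def step (q a : ℝ) (f : ℕ → ℝ) (x : ℕ) : ℝ :=
  serviceMean q (fun j => a * f (j + 1) + (1 - a) * f j) x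

theorem step_eq (q a : ℝ) (f : ℕ → ℝ) (x : ℕ) :
    step q a f x = serviceMean q f x + a * serviceMean q (fwdDiff 1 f) x := by
  rw [step, ← serviceMean_const_mul, ← serviceMean_add]
  congr 1; funext j; simp only [fwdDiff]; ring

theorem step_zero (q : ℝ) (f : ℕ → ℝ) (x : ℕ) : step q 0 f x = serviceMean q f x := by
  simp [step_eq]

theorem step_sub (q a : ℝ) (f g : ℕ → ℝ) (x : ℕ) :
    step q a (fun j => f j - g j) x = step q a f x - step q a g x := by
  simp only [step]; rw [← serviceMean_sub]; congr 1; funext j; ring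

theorem step_const_mul (q a c : ℝ) (f : ℕ → ℝ) (x : ℕ) :
    step q a (fun j => c * f j) x = c * step q a f x := by
  simp only [step]; rw [← serviceMean_const_mul]; congr 1; funext j; ring

theorem step_const (q a c : ℝ) (x : ℕ) : step q a (fun _ => c) x = c := by
  simp only [step]; rw [serviceMean_const]; ring

theorem step_mono {q a : ℝ} (hq₀ : 0 ≤ q) (hq : q ≤ 1) (ha : a ∈ Set.Icc (0 : ℝ) 1) {f g : ℕ → ℝ}
    {x : ℕ} (h : ∀ j, f j ≤ g j) : step q a f x ≤ step q a g x :=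
  serviceMean_mono hq₀ hq fun _ _ => add_le_add (mul_le_mul_of_nonneg_left (h _) ha.1)
    (mul_le_mul_of_nonneg_left (h _) (sub_nonneg.2 ha.2))

theorem tendsto_step {ι : Type*} {l : Filter ι} {F : ι → ℕ → ℝ} {f : ℕ → ℝ}
    (h : ∀ j, Tendsto (fun i => F i j) l (𝓝 (f j))) (q a : ℝ) (x : ℕ) :
    Tendsto (fun i => step q a (F i) x) l (𝓝 (step q a f x)) := by
  simp only [step, ← sum_departureProb_mul]
  exact tendsto_finsetSum _ fun d _ => tendsto_const_nhds.mul
    (((h _).const_mul _).add ((h _).const_mul _))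

/-- The operator of the dynamic programming equation with discount factor `α` whose running cost is
lowered by `b`. The choice `b = 0` gives the discounted equation, and `α = 1` the average-cost
equation. -/
def bellman (p q C lam α b : ℝ) (f : ℕ → ℝ) (x : ℕ) : ℝ :=
  C * x - b + min (α * step q p f x) (lam + α * step q 0 f x)

theorem solvesAverageCostDP_iff (p q C lam : ℝ) (V : ℕ → ℝ) (β : ℝ) :
    SolvesAverageCostDP p q C lam V β ↔ ∀ x, V x = bellman p q C lam 1 β V x := by
  refine forall_congr' fun x => ?_
  have h : ∑ d ∈ Finset.range (x + 1), departureProb q x d *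
      (p * V (x + 1 - d) + (1 - p) * V (x - d)) = step q p V x := by
    rw [step, ← sum_departureProb_mul]
    refine Finset.sum_congr rfl fun d hd => ?_
    rw [Nat.sub_add_comm (Nat.lt_succ_iff.1 (Finset.mem_range.1 hd))]
  rw [h, sum_departureProb_mul, bellman, step_zero, one_mul, one_mul]

theorem bellman_mono {p q C lam α b : ℝ} (hp : p ∈ Set.Icc (0 : ℝ) 1) (hq₀ : 0 ≤ q) (hq : q ≤ 1)
    (hα : 0 ≤ α) {f g : ℕ → ℝ} (h : ∀ j, f j ≤ g j) (x : ℕ) :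
    bellman p q C lam α b f x ≤ bellman p q C lam α b g x := by
  have h₁ := mul_le_mul_of_nonneg_left (step_mono hq₀ hq hp h (x := x)) hα
  have h₂ := mul_le_mul_of_nonneg_left
    (step_mono hq₀ hq ⟨le_rfl, zero_le_one⟩ h (x := x)) hα
  unfold bellman
  gcongr

theorem tendsto_bellman {ι : Type*} {l : Filter ι} {F : ι → ℕ → ℝ} {f : ℕ → ℝ} {A B : ι → ℝ}
    {α b : ℝ} (h : ∀ j, Tendsto (fun i => F i j) l (𝓝 (f j))) (hA : Tendsto A l (𝓝 α))
    (hB : Tendsto B l (𝓝 b)) (p q C lam : ℝ) (x : ℕ) :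
    Tendsto (fun i => bellman p q C lam (A i) (B i) (F i) x) l
      (𝓝 (bellman p q C lam α b f x)) :=
  (tendsto_const_nhds.sub hB).add ((hA.mul (tendsto_step h q p x)).min
    (tendsto_const_nhds.add (hA.mul (tendsto_step h q 0 x))))

/-- Queue cost functions that are increasing and have increasing differences. -/
structure IncreasingConvex (f : ℕ → ℝ) : Prop where
  monotone : Monotone f
  fwdDiff_monotone : Monotone (fwdDiff 1 f)

/-- With `Δ` for the forward difference and `S` for the service mean, the operator is
`C * x - b + α * S f + min (α * p * S (Δ f)) lam`. The minimum is concave in its argument, but over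
one more job it grows by at most `α * p` times the increment of `S (Δ f)`, and
`mul_serviceMean_fwdDiff_sub_le` provides that much from the second difference of `α * S f`. -/
theorem IncreasingConvex.bellman {p q C lam α b : ℝ} (hp : 0 ≤ p) (hp' : p ≤ 1 / 2) (hq₀ : 0 ≤ q)
    (hq : q ≤ 1) (hC : 0 ≤ C) (hα : 0 ≤ α) {f : ℕ → ℝ} (hf : IncreasingConvex f) :
    IncreasingConvex (bellman p q C lam α b f) := by
  have hg := serviceMean_monotone hq₀ hq hf.fwdDiff_monotone
  have hs := serviceMean_monotone hq₀ hq hf.monotone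
  have key : ∀ x, ProcessorSharing.bellman p q C lam α b f x = C * x - b + (α * serviceMean q f x
      + min (α * (p * serviceMean q (fwdDiff 1 f) x)) lam) := by
    intro x
    rw [ProcessorSharing.bellman, step_zero, step_eq, mul_add, add_comm lam, min_add_add_left]
  have hm : Monotone fun x => min (α * (p * serviceMean q (fwdDiff 1 f) x)) lam := fun x y h =>
    min_le_min_right _ (mul_le_mul_of_nonneg_left (mul_le_mul_of_nonneg_left (hg h) hp) hα)
  constructor
  · refine monotone_nat_of_le_succ fun x => ?_
    have h₁ := mul_le_mul_of_nonneg_left (hs (Nat.le_succ x)) hα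
    have h₂ := hm (Nat.le_succ x)
    rw [key, key]
    push_cast
    simp only [Nat.succ_eq_add_one] at *
    linarith
  · refine monotone_nat_of_le_succ fun x => ?_
    have h₁ := mul_le_mul_of_nonneg_left
      (mul_serviceMean_fwdDiff_sub_le hp hp' hq₀ hq hf.monotone hf.fwdDiff_monotone x) hα
    have h₂ := hm (Nat.le_succ (x + 1))
    have h₃ : 0 ≤ α * (p * (serviceMean q (fwdDiff 1 f) (x + 1)
        - serviceMean q (fwdDiff 1 f) x)) :=
      mul_nonneg hα (mul_nonneg hp (sub_nonneg.2 (hg (Nat.le_succ x))))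
    -- Truncation at `lam` does not expand the increments of the expected marginal cost.
    have h₄ : min (α * (p * serviceMean q (fwdDiff 1 f) (x + 1))) lam
        - min (α * (p * serviceMean q (fwdDiff 1 f) x)) lam
        ≤ α * (p * (serviceMean q (fwdDiff 1 f) (x + 1) - serviceMean q (fwdDiff 1 f) x)) := by
      rcases min_cases (α * (p * serviceMean q (fwdDiff 1 f) (x + 1))) lam with h | h <;>
      rcases min_cases (α * (p * serviceMean q (fwdDiff 1 f) x)) lam with h' | h' <;>
      linarith
    simp only [fwdDiff, key]
    push_cast
    simp only [Nat.succ_eq_add_one, add_assoc, Nat.reduceAdd] at *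
    linarith

theorem IncreasingConvex.of_tendsto {ι : Type*} {l : Filter ι} [l.NeBot] {F : ι → ℕ → ℝ}
    {f : ℕ → ℝ} (hF : ∀ᶠ i in l, IncreasingConvex (F i))
    (h : ∀ j, Tendsto (fun i => F i j) l (𝓝 (f j))) : IncreasingConvex f where
  monotone x y hxy := le_of_tendsto_of_tendsto (h x) (h y) (hF.mono fun _ hi => hi.monotone hxy)
  fwdDiff_monotone x y hxy := le_of_tendsto_of_tendsto ((h (x + 1)).sub (h x))
    ((h (y + 1)).sub (h y)) (hF.mono fun _ hi => hi.fwdDiff_monotone hxy)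

theorem IncreasingConvex.sub_le_sub {f : ℕ → ℝ} (hf : IncreasingConvex f) {x y : ℕ} (h : y ≤ x)
    (z : ℕ) : f (y + z) - f y ≤ f (x + z) - f x := by
  have : Monotone fun y => f (y + z) - f y := monotone_nat_of_le_succ fun y => by
    have := hf.fwdDiff_monotone (Nat.le_add_right y z)
    simp only [fwdDiff] at this
    rw [show y + 1 + z = y + z + 1 by ring]
    linarith
  exact this h

/-! ### Negative drift and the maximum principle -/

/-- The function `r ^ x` shrinks on average away from the empty queue, uniformly over the arrival
probabilities up to `p`, as soon as `r * p < q`; see `exp_drift_lt_one`. -/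
theorem step_pow_le {p q a r : ℝ} (hq₀ : 0 ≤ q) (hq : q ≤ 1) (ha : a ∈ Set.Icc (0 : ℝ) p)
    (hr : 1 ≤ r) {x : ℕ} (hx : x ≠ 0) :
    step q a (fun j => r ^ j) x ≤ Real.exp ((r - 1) * (p - q / r)) * r ^ x := by
  have hr₀ : 0 < r := by linarith
  have hx₀ : (0 : ℝ) < x := by exact_mod_cast Nat.pos_of_ne_zero hx
  have e₁ : step q a (fun j => r ^ j) x
      = (1 + a * (r - 1)) * (1 - (1 - q / x) + (1 - q / x) * r) ^ x := by
    rw [step, ← binMean_pow, ← serviceMean, ← serviceMean_const_mul]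
    congr 1; funext j; ring
  have e₂ : 1 - (1 - q / x) + (1 - q / x) * r = r * (-((r - 1) * (q / r) / x) + 1) := by
    field_simp; ring
  have h₁ : 1 + a * (r - 1) ≤ Real.exp ((r - 1) * p) := by
    have := Real.add_one_le_exp ((r - 1) * p)
    have := mul_le_mul_of_nonneg_right ha.2 (sub_nonneg.2 hr)
    linarith
  have h₃ : 0 ≤ -((r - 1) * (q / r) / x) + 1 := by
    have : 0 ≤ r * (-((r - 1) * (q / r) / x) + 1) := by
      have := survival_mem_Icc hq₀ hq x
      rw [← e₂]
      exact add_nonneg (sub_nonneg.2 this.2) (mul_nonneg this.1 hr₀.le)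
    exact nonneg_of_mul_nonneg_right this hr₀
  have h₂ : (-((r - 1) * (q / r) / x) + 1) ^ x ≤ Real.exp (-((r - 1) * (q / r))) := by
    calc _ ≤ Real.exp (-((r - 1) * (q / r) / x)) ^ x := by
          gcongr; exact Real.add_one_le_exp _
      _ = _ := by rw [← Real.exp_nat_mul]; congr 1; field_simp
  calc step q a (fun j => r ^ j) x
      = (1 + a * (r - 1)) * (r ^ x * (-((r - 1) * (q / r) / x) + 1) ^ x) := by
        rw [e₁, e₂, mul_pow]
    _ ≤ Real.exp ((r - 1) * p) * (r ^ x * Real.exp (-((r - 1) * (q / r)))) := by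
        gcongr
    _ = _ := by
        rw [show (r - 1) * (p - q / r) = (r - 1) * p + -((r - 1) * (q / r)) by ring, Real.exp_add]
        ring

theorem exp_drift_lt_one {p q r : ℝ} (hr : 1 < r) (h : r * p < q) :
    Real.exp ((r - 1) * (p - q / r)) < 1 := by
  have hr₀ : 0 < r := by linarith
  have : p < q / r := (lt_div_iff₀ hr₀).2 (by linarith)
  exact (Real.exp_lt_exp.2 (mul_neg_of_pos_of_neg (by linarith) (by linarith))).trans_eq
    Real.exp_zero

/-- Maximum principle: a function of moderate growth that is subharmonic, for some choice of the
control, away from the empty queue is maximal at the empty queue. Subtracting a small multiple of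
the Lyapunov function `2 ^ x` makes the maximum attained, and the drift rules out `x ≠ 0`. -/
theorem le_apply_zero_of_le_step {p q : ℝ} (hpq : 2 * p < q) (hq₀ : 0 ≤ q) (hq : q ≤ 1) {W : ℕ → ℝ}
    {K : ℝ} (hK : ∀ x, W x ≤ K * (3 / 2) ^ x)
    (hW : ∀ x, x ≠ 0 → ∃ a ∈ Set.Icc (0 : ℝ) p, W x ≤ step q a W x) (x : ℕ) : W x ≤ W 0 := by
  have hlt : ∀ δ : ℝ, 0 < δ → W x - δ * 2 ^ x ≤ W 0 := by
    intro δ hδ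
    have hlim : Tendsto (fun x : ℕ => W x - δ * 2 ^ x) cofinite atBot := by
      rw [Nat.cofinite_eq_atTop]
      have h₁ : Tendsto (fun x : ℕ => K * (3 / 4 : ℝ) ^ x - δ) atTop (𝓝 (K * 0 - δ)) :=
        ((tendsto_pow_atTop_nhds_zero_of_lt_one (by norm_num) (by norm_num)).const_mul K).sub_const
          δ
      have h₂ := (tendsto_pow_atTop_atTop_of_one_lt (r := (2 : ℝ)) (by norm_num)).atTop_mul_neg
        (by linarith : K * 0 - δ < 0) h₁
      refine tendsto_atBot_mono (fun x => ?_) h₂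
      have : (2 : ℝ) ^ x * (3 / 4) ^ x = (3 / 2) ^ x := by rw [← mul_pow]; norm_num
      linear_combination hK x - K * this
    obtain ⟨y, hy⟩ := hlim.exists_forall_ge
    rcases eq_or_ne y 0 with rfl | hy₀
    · have := hy x
      simp only [pow_zero] at this
      linarith
    · exfalso
      obtain ⟨a, ha, h₁⟩ := hW y hy₀
      have h₂ := step_pow_le hq₀ hq ha (one_le_two (α := ℝ)) hy₀
      have h₃ := mul_lt_mul_of_pos_right (exp_drift_lt_one (one_lt_two (α := ℝ)) hpq)
        (show (0 : ℝ) < 2 ^ y by positivity)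
      have h₄ := step_mono hq₀ hq ⟨ha.1, ha.2.trans (by linarith)⟩ (x := y) hy
      rw [step_sub, step_const_mul, step_const] at h₄
      have h₅ := mul_lt_mul_of_pos_left (h₂.trans_lt h₃) hδ
      linarith
  have h : Tendsto (fun δ : ℝ => W x - δ * 2 ^ x) (𝓝[>] 0) (𝓝 (W x - 0 * 2 ^ x)) :=
    ((continuous_const.sub (continuous_id.mul continuous_const)).tendsto 0).mono_left
      nhdsWithin_le_nhds
  rw [zero_mul, sub_zero] at h
  exact le_of_tendsto h (eventually_nhdsWithin_of_forall fun δ hδ => hlt δ hδ)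

/-- A nonnegative function of moderate growth, normalized at the empty queue, that solves the
average-cost equation with average cost `β`. -/
structure IsAverageSolution (p q C lam K : ℝ) (V : ℕ → ℝ) (β : ℝ) : Prop where
  eq : ∀ x, V x = bellman p q C lam 1 β V x
  zero : V 0 = 0
  nonneg : ∀ x, 0 ≤ V x
  le : ∀ x, V x ≤ K * (3 / 2) ^ x

/-- Under a control that is optimal for the second function, the difference of two functions of
dynamic programming type is subharmonic up to the difference of their constants. -/
theorem exists_bellman_sub_le (p q C lam b b' : ℝ) (hp : 0 ≤ p) (f g : ℕ → ℝ) (x : ℕ) :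
    ∃ a ∈ Set.Icc (0 : ℝ) p, bellman p q C lam 1 b f x - bellman p q C lam 1 b' g x
      ≤ b' - b + step q a (fun j => f j - g j) x := by
  simp only [step_sub, bellman, one_mul]
  rcases min_choice (step q p g x) (lam + step q 0 g x) with h | h
  · refine ⟨p, ⟨hp, le_rfl⟩, ?_⟩
    have := min_le_left (step q p f x) (lam + step q 0 f x)
    rw [h]; linarith
  · refine ⟨0, ⟨le_rfl, hp⟩, ?_⟩
    have := min_le_right (step q p f x) (lam + step q 0 f x)
    rw [h]; linarith

theorem IsAverageSolution.const_le {p q C lam K β β' : ℝ} (hp : 0 ≤ p) (hpq : 2 * p < q)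
    (hq : q ≤ 1) {V V' : ℕ → ℝ} (h : IsAverageSolution p q C lam K V β)
    (h' : IsAverageSolution p q C lam K V' β') : β ≤ β' := by
  have hW : ∀ x, ∃ a ∈ Set.Icc (0 : ℝ) p, V x - V' x
      ≤ β' - β + step q a (fun j => V j - V' j) x := by
    intro x
    have := exists_bellman_sub_le p q C lam β β' hp V V' x
    rwa [← h.eq, ← h'.eq] at this
  by_contra hlt
  have hm := le_apply_zero_of_le_step (W := fun j => V j - V' j) hpq (by linarith) hq
    (fun x => (sub_le_self _ (h'.nonneg x)).trans (h.le x))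
    (fun x _ => by
      obtain ⟨a, ha, hx⟩ := hW x
      exact ⟨a, ha, by linarith⟩)
  obtain ⟨a, ha, h₀⟩ := hW 0
  have h₁ := step_mono (by linarith) hq ⟨ha.1, ha.2.trans (by linarith)⟩ (x := 0) hm
  rw [step_const] at h₁
  linarith

theorem IsAverageSolution.unique {p q C lam K β β' : ℝ} (hp : 0 ≤ p) (hpq : 2 * p < q)
    (hq : q ≤ 1) {V V' : ℕ → ℝ} (h : IsAverageSolution p q C lam K V β)
    (h' : IsAverageSolution p q C lam K V' β') : V = V' ∧ β = β' := by
  have hβ : β = β' := le_antisymm (h.const_le hp hpq hq h') (h'.const_le hp hpq hq h)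
  subst hβ
  have key : ∀ {U U' : ℕ → ℝ}, IsAverageSolution p q C lam K U β →
      IsAverageSolution p q C lam K U' β → ∀ x, U x ≤ U' x := by
    intro U U' hU hU' x
    have := le_apply_zero_of_le_step (W := fun j => U j - U' j) hpq (by linarith) hq
      (fun x => (sub_le_self _ (hU'.nonneg x)).trans (hU.le x))
      (fun x _ => by
        have := exists_bellman_sub_le p q C lam β β hp U U' x
        rw [← hU.eq, ← hU'.eq, sub_self] at this
        simpa only [zero_add] using this) x
    simp only [hU.zero, hU'.zero] at this
    linarith
  exact ⟨funext fun x => le_antisymm (key h h' x) (key h' h x), rfl⟩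

/-! ### The discounted problem -/

theorem serviceMean_le_self {q : ℝ} (hq₀ : 0 ≤ q) (hq : q ≤ 1) {f : ℕ → ℝ} (hf : Monotone f)
    (x : ℕ) : serviceMean q f x ≤ f x :=
  (serviceMean_mono hq₀ hq fun _ hj => hf hj).trans_eq (serviceMean_const q (f x) x)

/-- Value iteration, started from a constant below all costs, increases to a solution of the
discounted equation that inherits convexity from the iterates. -/
theorem exists_discounted_solution {p q C lam α : ℝ} (hp : 0 ≤ p) (hp' : p ≤ 1 / 2) (hq₀ : 0 ≤ q)
    (hq : q ≤ 1) (hC : 0 ≤ C) (hα₀ : 0 ≤ α) (hα : α < 1) :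
    ∃ v : ℕ → ℝ, (∀ x, v x = bellman p q C lam α 0 v x) ∧ IncreasingConvex v ∧
      -|lam| ≤ (1 - α) * v 0 ∧ ∃ K : ℝ, ∀ x, |v x| ≤ K * (1 + x) := by
  have hα' : 0 < 1 - α := by linarith
  set m : ℝ := |lam| / (1 - α) with hm
  have hm₁ : |lam| = m - α * m := by rw [hm]; field_simp
  have hm₀ : 0 ≤ m := by positivity
  set k : ℝ := C / (1 - α) with hk
  have hk₁ : C = k - α * k := by rw [hk]; field_simp
  have hk₀ : 0 ≤ k := by positivity
  set T : (ℕ → ℝ) → ℕ → ℝ := bellman p q C lam α 0 with hT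
  have hpI : p ∈ Set.Icc (0 : ℝ) 1 := ⟨hp, by linarith⟩
  have hTmono : Monotone T := fun f g hfg x => bellman_mono hpI hq₀ hq hα₀ hfg x
  set lo : ℕ → ℝ := fun _ => -m with hlo
  set hi : ℕ → ℝ := fun x => k * x + m with hhi
  have hlo₁ : lo ≤ T lo := by
    intro x
    have h₁ : 0 ≤ C * (x : ℝ) := by positivity
    have h₂ : -|lam| + α * -m ≤ min (α * -m) (lam + α * -m) :=
      le_min (by linarith [abs_nonneg lam]) (by linarith [neg_abs_le lam])
    simp only [hT, bellman, hlo, step_const]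
    linarith
  have hhi₁ : T hi ≤ hi := by
    intro x
    have hmono : Monotone hi := fun a b hab => by
      have : (a : ℝ) ≤ b := by exact_mod_cast hab
      simp only [hhi]; gcongr
    have h₁ := mul_le_mul_of_nonneg_left (serviceMean_le_self hq₀ hq hmono x) hα₀
    have h₂ : min (α * step q p hi x) (lam + α * step q 0 hi x) ≤ |lam| + α * hi x := by
      rw [step_zero]
      exact (min_le_right _ _).trans (add_le_add (le_abs_self lam) h₁)
    have h₃ : C * (x : ℝ) = (k - α * k) * x := by rw [← hk₁]
    have h₄ : hi x = k * x + m := rfl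
    rw [h₄] at h₂ ⊢
    simp only [hT, bellman]
    linear_combination h₂ + h₃ + hm₁
  have hlohi : lo ≤ hi := fun x => by
    have : 0 ≤ k * (x : ℝ) := by positivity
    simp only [hlo, hhi]; linarith
  have hup : ∀ n, T^[n] lo ≤ hi := by
    intro n
    induction n with
    | zero => exact hlohi
    | succ n ih => rw [Function.iterate_succ_apply']; exact (hTmono ih).trans hhi₁
  have hinc : Monotone fun n => T^[n] lo := hTmono.monotone_iterate_of_le_map hlo₁
  have hconv : ∀ n, IncreasingConvex (T^[n] lo) := by
    intro n
    induction n with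
    | zero => exact ⟨fun _ _ _ => le_rfl, fun _ _ _ => by simp [fwdDiff, hlo]⟩
    | succ n ih => rw [Function.iterate_succ_apply']; exact ih.bellman hp hp' hq₀ hq hC hα₀
  have hlim : ∀ x, Tendsto (fun n => T^[n] lo x) atTop (𝓝 (⨆ n, T^[n] lo x)) := fun x =>
    tendsto_atTop_ciSup (fun _ _ h => hinc h x) ⟨hi x, by rintro _ ⟨n, rfl⟩; exact hup n x⟩
  have hge : ∀ x, -m ≤ ⨆ n, T^[n] lo x := fun x =>
    ge_of_tendsto' (hlim x) fun n => hinc (Nat.zero_le n) x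
  have hle : ∀ x, ⨆ n, T^[n] lo x ≤ hi x := fun x => le_of_tendsto' (hlim x) fun n => hup n x
  refine ⟨fun x => ⨆ n, T^[n] lo x, fun x => ?_, .of_tendsto (.of_forall hconv) hlim, ?_,
    k + m, fun x => ?_⟩
  · have h₁ := (hlim x).comp (tendsto_add_atTop_nat 1)
    have h₂ := tendsto_bellman hlim (tendsto_const_nhds (x := α)) (tendsto_const_nhds (x := (0 : ℝ)))
      p q C lam x
    refine tendsto_nhds_unique h₁ (h₂.congr fun n => ?_)
    simp only [Function.comp_apply, Function.iterate_succ_apply', hT]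
  · have := mul_le_mul_of_nonneg_left (hge 0) hα'.le
    linarith
  · have hx : (0 : ℝ) ≤ x := Nat.cast_nonneg x
    have h₁ := hge x
    have h₂ := hle x
    simp only [hhi] at h₂
    have h₃ := mul_nonneg hm₀ hx
    have h₄ := mul_nonneg hk₀ hx
    exact abs_le.2 ⟨by linarith, by linarith⟩

/-! ### Expectations along a control and verification -/

/-- The conditional mean, given the history `h`, of `f` at the history that is one slot longer. -/
def slotMean (p q : ℝ) (π : Control) (x₀ : ℕ) (f : History → ℝ) (h : History) : ℝ :=
  ∑ ν : Bool, ∑ d ∈ Finset.range (state x₀ h + 1), ∑ ξ : Bool,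
    controlProb π h ν * departureProb q (state x₀ h) d * arrivalProb p ξ * f ((ν, d, ξ) :: h)

theorem expect_succ (p q : ℝ) (π : Control) (x₀ t : ℕ) (f : History → ℝ) :
    expect p q π x₀ (t + 1) f = expect p q π x₀ t (slotMean p q π x₀ f) := rfl

theorem slotMean_add (p q : ℝ) (π : Control) (x₀ : ℕ) (f g : History → ℝ) :
    slotMean p q π x₀ (fun h => f h + g h)
      = fun h => slotMean p q π x₀ f h + slotMean p q π x₀ g h := by
  funext h
  simp only [slotMean, mul_add, Finset.sum_add_distrib]

theorem slotMean_const_mul (p q : ℝ) (π : Control) (x₀ : ℕ) (c : ℝ) (f : History → ℝ) :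
    slotMean p q π x₀ (fun h => c * f h) = fun h => c * slotMean p q π x₀ f h := by
  funext h
  simp only [slotMean, Finset.mul_sum]
  refine Finset.sum_congr rfl fun _ _ => Finset.sum_congr rfl fun _ _ =>
    Finset.sum_congr rfl fun _ _ => by ring

/-- A function of the queue length alone evolves by the transition means of the two controls. -/
theorem slotMean_state (p q : ℝ) (π : Control) (x₀ : ℕ) (f : ℕ → ℝ) (h : History) :
    slotMean p q π x₀ (fun h => f (state x₀ h)) h
      = π h * step q p f (state x₀ h) + (1 - π h) * step q 0 f (state x₀ h) := by
  simp only [slotMean, Fintype.sum_bool, controlProb, arrivalProb, state, step,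
    ← sum_departureProb_mul, Finset.mul_sum, ← Finset.sum_add_distrib]
  refine Finset.sum_congr rfl fun d _ => ?_
  simp
  ring

theorem slotMean_const (p q : ℝ) (π : Control) (x₀ : ℕ) (c : ℝ) :
    slotMean p q π x₀ (fun _ => c) = fun _ => c := by
  funext h
  rw [slotMean_state p q π x₀ (fun _ => c), step_const, step_const]; ring

theorem slotMean_mono {p q : ℝ} (hp : p ∈ Set.Icc (0 : ℝ) 1) (hq₀ : 0 ≤ q) (hq : q ≤ 1)
    (π : Control) (x₀ : ℕ) {f g : History → ℝ} {h : History}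
    (hfg : ∀ s, f (s :: h) ≤ g (s :: h)) : slotMean p q π x₀ f h ≤ slotMean p q π x₀ g h := by
  refine Finset.sum_le_sum fun ν _ => Finset.sum_le_sum fun d _ => Finset.sum_le_sum fun ξ _ => ?_
  refine mul_le_mul_of_nonneg_left (hfg _) (mul_nonneg (mul_nonneg ?_ ?_) ?_)
  · have := (π h).2
    cases ν <;> simp [controlProb, this.1, this.2]
  · have := survival_mem_Icc hq₀ hq (state x₀ h)
    exact mul_nonneg (mul_nonneg (Nat.cast_nonneg _) (pow_nonneg (by linarith [this.2]) _))
      (pow_nonneg this.1 _)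
  · cases ξ <;> simp [arrivalProb, hp.1, hp.2]

theorem expect_add (p q : ℝ) (π : Control) (x₀ t : ℕ) (f g : History → ℝ) :
    expect p q π x₀ t (fun h => f h + g h) = expect p q π x₀ t f + expect p q π x₀ t g := by
  induction t generalizing f g with
  | zero => rfl
  | succ t ih => rw [expect_succ, slotMean_add, ih, expect_succ, expect_succ]

theorem expect_const_mul (p q : ℝ) (π : Control) (x₀ t : ℕ) (c : ℝ) (f : History → ℝ) :
    expect p q π x₀ t (fun h => c * f h) = c * expect p q π x₀ t f := by
  induction t generalizing f with
  | zero => rfl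
  | succ t ih => rw [expect_succ, slotMean_const_mul, ih, expect_succ]

theorem expect_const (p q : ℝ) (π : Control) (x₀ t : ℕ) (c : ℝ) :
    expect p q π x₀ t (fun _ => c) = c := by
  induction t with
  | zero => rfl
  | succ t ih => rw [expect_succ, slotMean_const, ih]

theorem expect_mono {p q : ℝ} (hp : p ∈ Set.Icc (0 : ℝ) 1) (hq₀ : 0 ≤ q) (hq : q ≤ 1)
    (π : Control) (x₀ t : ℕ) {f g : History → ℝ} (hfg : ∀ h, h.length = t → f h ≤ g h) :
    expect p q π x₀ t f ≤ expect p q π x₀ t g := by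
  induction t generalizing f g with
  | zero => exact hfg [] rfl
  | succ t ih =>
    exact ih fun h hh => slotMean_mono hp hq₀ hq π x₀ fun s => hfg _ (by simp [hh])

theorem abs_expect_le {p q : ℝ} (hp : p ∈ Set.Icc (0 : ℝ) 1) (hq₀ : 0 ≤ q) (hq : q ≤ 1)
    (π : Control) (x₀ t : ℕ) {f : History → ℝ} {c : ℝ} (hf : ∀ h, h.length = t → |f h| ≤ c) :
    |expect p q π x₀ t f| ≤ c := by
  have h₁ := expect_mono hp hq₀ hq π x₀ t (f := f) (g := fun _ => c)
    fun h hh => (abs_le.1 (hf h hh)).2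
  have h₂ := expect_mono hp hq₀ hq π x₀ t (f := fun _ => -c) (g := f)
    fun h hh => (abs_le.1 (hf h hh)).1
  rw [expect_const] at h₁ h₂
  exact abs_le.2 ⟨h₂, h₁⟩

theorem state_le (x₀ : ℕ) (h : History) : state x₀ h ≤ x₀ + h.length := by
  induction h with
  | nil => simp [state]
  | cons s h ih =>
    obtain ⟨ν, d, ξ⟩ := s
    simp only [state, List.length_cons]
    split <;> omega

theorem slotCost_eq (C lam : ℝ) (π : Control) (x₀ : ℕ) (h : History) :
    ∑ ν : Bool, controlProb π h ν * runningCost C lam (state x₀ h) ν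
      = C * state x₀ h + (1 - π h) * lam := by
  simp [controlProb, runningCost]; ring

theorem abs_expectedCost_le {p q C lam : ℝ} (hp : p ∈ Set.Icc (0 : ℝ) 1) (hq₀ : 0 ≤ q)
    (hq : q ≤ 1) (hC : 0 ≤ C) (π : Control) (x₀ t : ℕ) :
    |expectedCost p q C lam π x₀ t| ≤ C * (x₀ + t) + |lam| := by
  refine abs_expect_le hp hq₀ hq π x₀ t fun h hh => ?_
  have hx : (state x₀ h : ℝ) ≤ x₀ + t := by
    have := state_le x₀ h
    rw [hh] at this
    exact_mod_cast this
  rw [slotCost_eq]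
  have hπ := (π h).2
  refine (abs_add_le _ _).trans (add_le_add ?_ ?_)
  · rw [abs_of_nonneg (by positivity)]; gcongr
  · rw [abs_mul, abs_of_nonneg (sub_nonneg.2 hπ.2)]
    exact mul_le_of_le_one_left (abs_nonneg _) (by linarith [hπ.1])

theorem summable_pow_mul_linear {α : ℝ} (hα₀ : 0 ≤ α) (hα : α < 1) (a b : ℝ) :
    Summable fun t : ℕ => α ^ t * (a * t + b) := by
  have h₁ := summable_pow_mul_geometric_of_norm_lt_one 1
    (show ‖α‖ < 1 by rwa [Real.norm_of_nonneg hα₀])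
  have h₂ := summable_geometric_of_lt_one hα₀ hα
  refine ((h₁.mul_left a).add (h₂.mul_left b)).congr fun t => ?_
  ring

theorem hasSum_discountedCost {p q C lam α : ℝ} (hp : p ∈ Set.Icc (0 : ℝ) 1) (hq₀ : 0 ≤ q)
    (hq : q ≤ 1) (hC : 0 ≤ C) (hα₀ : 0 ≤ α) (hα : α < 1) (π : Control) (x₀ : ℕ) :
    HasSum (fun t => α ^ t * expectedCost p q C lam π x₀ t)
      (discountedCost p q C lam α π x₀) := by
  refine (Summable.of_norm_bounded (summable_pow_mul_linear hα₀ hα C (C * x₀ + |lam|))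
    fun t => ?_).hasSum
  rw [norm_mul, norm_pow, Real.norm_of_nonneg hα₀]
  have := abs_expectedCost_le (lam := lam) hp hq₀ hq hC π x₀ t
  gcongr
  rw [Real.norm_eq_abs]; linarith

/-- The cost over the first `t` slots together with the discounted value of the queue length that is
then reached; these totals compare a control with a solution of the discounted equation. -/
def truncatedCost (p q C lam α : ℝ) (v : ℕ → ℝ) (π : Control) (x₀ t : ℕ) : ℝ :=
  ∑ s ∈ Finset.range t, α ^ s * expectedCost p q C lam π x₀ s
    + α ^ t * expect p q π x₀ t fun h => v (state x₀ h)

theorem truncatedCost_zero (p q C lam α : ℝ) (v : ℕ → ℝ) (π : Control) (x₀ : ℕ) :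
    truncatedCost p q C lam α v π x₀ 0 = v x₀ := by
  simp [truncatedCost, expect, state]

theorem truncatedCost_succ (p q C lam α : ℝ) (v : ℕ → ℝ) (π : Control) (x₀ t : ℕ) :
    truncatedCost p q C lam α v π x₀ (t + 1)
      = ∑ s ∈ Finset.range t, α ^ s * expectedCost p q C lam π x₀ s
        + α ^ t * expect p q π x₀ t fun h => C * state x₀ h
          + (π h * (α * step q p v (state x₀ h))
            + (1 - π h) * (lam + α * step q 0 v (state x₀ h))) := by
  have h₁ : ∀ h, C * state x₀ h + (π h * (α * step q p v (state x₀ h))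
      + (1 - π h) * (lam + α * step q 0 v (state x₀ h)))
      = ∑ ν : Bool, controlProb π h ν * runningCost C lam (state x₀ h) ν
        + α * slotMean p q π x₀ (fun h => v (state x₀ h)) h := by
    intro h
    rw [slotCost_eq, slotMean_state]; ring
  simp only [h₁]
  rw [expect_add, expect_const_mul, truncatedCost, Finset.sum_range_succ, expect_succ, expectedCost]
  ring

theorem tendsto_truncatedCost {p q C lam α : ℝ} (hp : p ∈ Set.Icc (0 : ℝ) 1) (hq₀ : 0 ≤ q)
    (hq : q ≤ 1) (hC : 0 ≤ C) (hα₀ : 0 ≤ α) (hα : α < 1) {v : ℕ → ℝ} {K : ℝ}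
    (hK : ∀ x, |v x| ≤ K * (1 + x)) (π : Control) (x₀ : ℕ) :
    Tendsto (truncatedCost p q C lam α v π x₀) atTop (𝓝 (discountedCost p q C lam α π x₀)) := by
  have hK₀ : 0 ≤ K := by simpa using (abs_nonneg _).trans (hK 0)
  have h₁ : Tendsto (fun t => α ^ t * expect p q π x₀ t fun h => v (state x₀ h)) atTop (𝓝 0) := by
    refine squeeze_zero_norm (fun t => ?_)
      (summable_pow_mul_linear hα₀ hα K (K * (1 + x₀))).tendsto_atTop_zero
    rw [norm_mul, norm_pow, Real.norm_of_nonneg hα₀]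
    gcongr
    refine abs_expect_le hp hq₀ hq π x₀ t fun h hh => (hK _).trans ?_
    have hx : (state x₀ h : ℝ) ≤ x₀ + t := by
      have := state_le x₀ h
      rw [hh] at this
      exact_mod_cast this
    have := mul_le_mul_of_nonneg_left hx hK₀
    linarith
  have h₂ := (hasSum_discountedCost (lam := lam) hp hq₀ hq hC hα₀ hα π x₀).tendsto_sum_nat.add h₁
  rwa [add_zero] at h₂

/-- Verification: a solution of the discounted equation of linear growth is the value function. No
control does better, and the control that attains the minimum in the equation does as well. -/
theorem discountedValue_eq {p q C lam α : ℝ} (hp : p ∈ Set.Icc (0 : ℝ) 1) (hq₀ : 0 ≤ q)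
    (hq : q ≤ 1) (hC : 0 ≤ C) (hα₀ : 0 ≤ α) (hα : α < 1) {v : ℕ → ℝ} {K : ℝ}
    (hv : ∀ x, v x = bellman p q C lam α 0 v x) (hK : ∀ x, |v x| ≤ K * (1 + x)) (x₀ : ℕ) :
    discountedValue p q C lam α x₀ = v x₀ := by
  have hlow : ∀ π : Control, v x₀ ≤ discountedCost p q C lam α π x₀ := by
    intro π
    have hmono : Monotone (truncatedCost p q C lam α v π x₀) := by
      refine monotone_nat_of_le_succ fun t => ?_
      rw [truncatedCost_succ, truncatedCost]
      gcongr
      refine expect_mono hp hq₀ hq π x₀ t fun h _ => ?_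
      have hπ := (π h).2
      have h₁ := mul_le_mul_of_nonneg_left (min_le_left (α * step q p v (state x₀ h))
        (lam + α * step q 0 v (state x₀ h))) hπ.1
      have h₂ := mul_le_mul_of_nonneg_left (min_le_right (α * step q p v (state x₀ h))
        (lam + α * step q 0 v (state x₀ h))) (sub_nonneg.2 hπ.2)
      rw [hv, bellman]
      linarith
    have := hmono.ge_of_tendsto (tendsto_truncatedCost hp hq₀ hq hC hα₀ hα hK π x₀) 0
    rwa [truncatedCost_zero] at this
  let π : Control := fun h =>
    if α * step q p v (state x₀ h) ≤ lam + α * step q 0 v (state x₀ h) then 1 else 0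
  have hπ : discountedCost p q C lam α π x₀ = v x₀ := by
    have hconst : ∀ t, truncatedCost p q C lam α v π x₀ t = v x₀ := by
      intro t
      induction t with
      | zero => exact truncatedCost_zero ..
      | succ t ih =>
        rw [← ih, truncatedCost_succ, truncatedCost]
        congr 3
        funext h
        rw [hv (state x₀ h), bellman, sub_zero]
        congr 1
        simp only [π]
        split_ifs with hle
        · rw [min_eq_left hle]; simp
        · rw [min_eq_right (not_le.1 hle).le]; simp
    have := tendsto_truncatedCost (lam := lam) hp hq₀ hq hC hα₀ hα hK π x₀
    rw [funext hconst] at this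
    exact tendsto_nhds_unique this tendsto_const_nhds
  refine le_antisymm ?_ (le_ciInf hlow)
  exact (ciInf_le ⟨v x₀, by rintro _ ⟨π, rfl⟩; exact hlow π⟩ π).trans_eq hπ

/-! ### The vanishing discount limit -/

theorem discountedValue_spec {p q C lam α : ℝ} (hp : 0 ≤ p) (hp' : p ≤ 1 / 2) (hq₀ : 0 ≤ q)
    (hq : q ≤ 1) (hC : 0 ≤ C) (hα₀ : 0 ≤ α) (hα : α < 1) :
    (∀ x, discountedValue p q C lam α x
      = bellman p q C lam α 0 (discountedValue p q C lam α) x) ∧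
    IncreasingConvex (discountedValue p q C lam α) ∧
    -|lam| ≤ (1 - α) * discountedValue p q C lam α 0 ∧
    ∃ K : ℝ, ∀ x, |discountedValue p q C lam α x| ≤ K * (1 + x) := by
  obtain ⟨v, hv, hconv, hlow, K, hK⟩ :=
    exists_discounted_solution (lam := lam) hp hp' hq₀ hq hC hα₀ hα
  have h : discountedValue p q C lam α = v := funext fun x =>
    discountedValue_eq ⟨hp, by linarith⟩ hq₀ hq hC hα₀ hα hv hK x
  rw [h]
  exact ⟨hv, hconv, hlow, K, hK⟩

theorem relativeValue_eq_bellman {p q C lam α : ℝ} (h : ∀ x, discountedValue p q C lam α x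
    = bellman p q C lam α 0 (discountedValue p q C lam α) x) (x : ℕ) :
    relativeValue p q C lam α x = bellman p q C lam α ((1 - α) * discountedValue p q C lam α 0)
      (relativeValue p q C lam α) x := by
  have e : relativeValue p q C lam α = fun x =>
      discountedValue p q C lam α x - (fun _ => discountedValue p q C lam α 0) x := rfl
  rw [bellman, e, step_sub, step_sub, step_const, step_const]
  simp only
  nth_rw 1 [h x, bellman]
  rw [mul_sub, mul_sub, ← add_sub_assoc, min_sub_sub_right]
  ring

theorem relativeValue_zero (p q C lam α : ℝ) : relativeValue p q C lam α 0 = 0 := sub_self _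

theorem one_sub_mul_discountedValue_zero_le {p q C lam α : ℝ} (h : ∀ x,
    discountedValue p q C lam α x = bellman p q C lam α 0 (discountedValue p q C lam α) x) :
    (1 - α) * discountedValue p q C lam α 0 ≤ lam := by
  have h₀ := h 0
  have h₁ := min_le_right (α * step q p (discountedValue p q C lam α) 0)
    (lam + α * step q 0 (discountedValue p q C lam α) 0)
  have h₂ : step q 0 (discountedValue p q C lam α) 0 = discountedValue p q C lam α 0 := by
    rw [step_zero]; rfl
  rw [bellman] at h₀
  rw [h₂] at h₀ h₁
  simp only [Nat.cast_zero, mul_zero] at h₀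
  linarith

theorem one_add_le_two_mul_pow (x : ℕ) : 1 + (x : ℝ) ≤ 2 * (3 / 2) ^ x := by
  have := one_add_mul_le_pow (show (-2 : ℝ) ≤ 1 / 2 by norm_num) x
  norm_num at this
  have hx : (0 : ℝ) ≤ x := Nat.cast_nonneg x
  linarith

/-- A bound that does not depend on the discount factor. When all arrivals are rejected, the Lyapunov
function `(3 / 2) ^ x` decreases by a fixed fraction in every slot until the queue is empty, which
pays for the linear running cost. -/
theorem exists_relativeValue_le {p q C : ℝ} (hp : 0 ≤ p) (hpq : 2 * p < q) (hq : q ≤ 1)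
    (hC : 0 ≤ C) (lam : ℝ) :
    ∃ K : ℝ, ∀ α, 0 ≤ α → α < 1 → ∀ x, relativeValue p q C lam α x ≤ K * (3 / 2) ^ x := by
  have hq₀ : 0 ≤ q := by linarith
  have hρ := exp_drift_lt_one (p := p) (q := q) (r := 3 / 2) (by norm_num) (by linarith)
  set ρ := Real.exp ((3 / 2 - 1) * (p - q / (3 / 2))) with hρdef
  set D := C + 2 * |lam| with hD
  have hD₀ : 0 ≤ D := by positivity
  set K := 2 * D / (1 - ρ) with hKdef
  have hKρ : K - K * ρ = 2 * D := by
    have : 1 - ρ ≠ 0 := by linarith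
    rw [hKdef]; field_simp
  have hK₀ : 0 ≤ K := div_nonneg (by linarith) (by linarith)
  refine ⟨K, fun α hα₀ hα x => ?_⟩
  obtain ⟨hV, hconv, hlow, K', hK'⟩ :=
    discountedValue_spec (lam := lam) hp (by linarith) hq₀ hq hC hα₀ hα
  have hw := relativeValue_eq_bellman hV
  have hw₀ : ∀ x, 0 ≤ relativeValue p q C lam α x := fun x =>
    sub_nonneg.2 (hconv.monotone (Nat.zero_le x))
  have hK'₀ : 0 ≤ K' := by simpa using (abs_nonneg _).trans (hK' 0)
  have hgrow : ∀ x, relativeValue p q C lam α x - K * (3 / 2) ^ x ≤ 4 * K' * (3 / 2) ^ x := by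
    intro x
    have h₁ := (abs_le.1 (hK' x)).2
    have h₂ := (abs_le.1 (hK' 0)).1
    have h₃ := mul_le_mul_of_nonneg_left (one_add_le_two_mul_pow x) hK'₀
    have h₄ : K' * (1 + ((0 : ℕ) : ℝ)) ≤ K' * (1 + x) := by gcongr; simp
    have h₅ : 0 ≤ K * (3 / 2 : ℝ) ^ x := by positivity
    rw [relativeValue]
    linarith
  have hmain := le_apply_zero_of_le_step hpq hq₀ hq hgrow (fun x hx => ⟨0, ⟨le_rfl, hp⟩, by
    have h₁ := step_pow_le hq₀ hq (⟨le_rfl, hp⟩ : (0 : ℝ) ∈ Set.Icc 0 p)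
      (show (1 : ℝ) ≤ 3 / 2 by norm_num) hx
    have h₂ := mul_le_mul_of_nonneg_left h₁ hK₀
    have h₃ : relativeValue p q C lam α x ≤ C * x + 2 * |lam|
        + step q 0 (relativeValue p q C lam α) x := by
      have h₄ : 0 ≤ step q 0 (relativeValue p q C lam α) x := by
        simpa [step_const] using
          step_mono hq₀ hq ⟨le_rfl, zero_le_one⟩ (f := fun _ => 0) (x := x) hw₀
      have h₅ := mul_le_of_le_one_left h₄ hα.le
      have h₆ := min_le_right (α * step q p (relativeValue p q C lam α) x)
        (lam + α * step q 0 (relativeValue p q C lam α) x)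
      rw [hw x, bellman]
      linarith [le_abs_self lam]
    have h₄ : C * (x : ℝ) + 2 * |lam| ≤ D * (1 + x) := by
      have : 0 ≤ |lam| * (x : ℝ) := by positivity
      rw [hD]; linarith
    have h₅ := mul_le_mul_of_nonneg_left (one_add_le_two_mul_pow x) hD₀
    rw [step_sub, step_const_mul]
    linear_combination h₂ + h₃ + h₄ + h₅ - (3 / 2 : ℝ) ^ x * hKρ⟩) x
  rw [relativeValue_zero, pow_zero] at hmain
  linarith

/-- Along the compact family of relative values and normalized costs, every cluster point as
`α ↑ 1` solves the average-cost equation; that equation has only one solution of moderate growth,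
so the family converges. -/
theorem exists_isAverageSolution_tendsto {p q C : ℝ} (hp : 0 ≤ p) (hpq : 2 * p < q) (hq : q ≤ 1)
    (hC : 0 ≤ C) (lam : ℝ) :
    ∃ (K : ℝ) (V : ℕ → ℝ) (β : ℝ), IsAverageSolution p q C lam K V β ∧
      (∀ x, Tendsto (fun α => relativeValue p q C lam α x) (𝓝[<] 1) (𝓝 (V x))) ∧
      Tendsto (fun α : ℝ => (1 - α) * discountedValue p q C lam α 0) (𝓝[<] 1) (𝓝 β) := by
  have hq₀ : 0 ≤ q := by linarith
  obtain ⟨K, hK⟩ := exists_relativeValue_le hp hpq hq hC lam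
  set F : ℝ → (ℕ → ℝ) × ℝ := fun α =>
    (relativeValue p q C lam α, (1 - α) * discountedValue p q C lam α 0) with hF
  set s : Set ((ℕ → ℝ) × ℝ) :=
    (Set.univ.pi fun x => Set.Icc 0 (K * (3 / 2) ^ x)) ×ˢ Set.Icc (-|lam|) lam with hs
  have hcomp : IsCompact s := (isCompact_univ_pi fun _ => isCompact_Icc).prod isCompact_Icc
  have hev : ∀ᶠ α in 𝓝[<] (1 : ℝ), 0 ≤ α ∧ α < 1 :=
    (eventually_nhdsWithin_of_eventually_nhds (eventually_ge_nhds zero_lt_one)).and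
      self_mem_nhdsWithin
  have hspec := fun (α : ℝ) (hα : 0 ≤ α ∧ α < 1) =>
    discountedValue_spec (lam := lam) hp (by linarith) hq₀ hq hC hα.1 hα.2
  have hmem : ∀ᶠ α in 𝓝[<] (1 : ℝ), F α ∈ s := hev.mono fun α hα => by
    obtain ⟨hV, hconv, hlow, -⟩ := hspec α hα
    exact ⟨fun x _ => ⟨sub_nonneg.2 (hconv.monotone (Nat.zero_le x)), hK α hα.1 hα.2 x⟩,
      hlow, one_sub_mul_discountedValue_zero_le hV⟩
  have hcluster : ∀ y ∈ s, MapClusterPt y (𝓝[<] (1 : ℝ)) F →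
      IsAverageSolution p q C lam K y.1 y.2 := by
    intro y hy hcl
    obtain ⟨U, hU, hlim⟩ := mapClusterPt_iff_ultrafilter.1 hcl
    have h₁ : ∀ x, Tendsto (fun α => relativeValue p q C lam α x) U (𝓝 (y.1 x)) := fun x =>
      ((continuous_apply x).tendsto _).comp ((continuous_fst.tendsto y).comp hlim)
    have h₂ : Tendsto (fun α : ℝ => (1 - α) * discountedValue p q C lam α 0) U (𝓝 y.2) :=
      (continuous_snd.tendsto y).comp hlim
    have h₃ : Tendsto (fun α : ℝ => α) U (𝓝 1) :=
      tendsto_id'.2 (hU.trans nhdsWithin_le_nhds)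
    refine ⟨fun x => ?_, ?_, fun x => (hy.1 x trivial).1, fun x => (hy.1 x trivial).2⟩
    · refine tendsto_nhds_unique (h₁ x) ((tendsto_bellman h₁ h₃ h₂ p q C lam x).congr' ?_)
      exact (hev.filter_mono hU).mono fun α hα => (relativeValue_eq_bellman (hspec α hα).1 x).symm
    · refine tendsto_nhds_unique (h₁ 0) ?_
      simp only [relativeValue_zero]
      exact tendsto_const_nhds
  obtain ⟨y, hy, hcl⟩ := hcomp.exists_mapClusterPt_of_frequently hmem.frequently
  have hysol := hcluster y hy hcl
  have hlim : Tendsto F (𝓝[<] 1) (𝓝 y) :=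
    hcomp.tendsto_nhds_of_unique_mapClusterPt hmem fun z hz hzcl => by
      have := (hcluster z hz hzcl).unique hp hpq hq hysol
      exact Prod.ext this.1 this.2
  exact ⟨K, y.1, y.2, hysol,
    fun x => ((continuous_apply x).tendsto _).comp ((continuous_fst.tendsto y).comp hlim),
    (continuous_snd.tendsto y).comp hlim⟩

end ProcessorSharing

end

open ProcessorSharing in
theorem mainTheorem5 (p q C lam : ℝ) (hp : 0 < p) (hpq : 2 * p < q) (hq : q < 1) (hC : 0 < C) :
    (∀ x : ℕ, Tendsto (fun α : ℝ => relativeValue p q C lam α x) (𝓝[<] 1)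
      (𝓝 (averageCostValue p q C lam x))) ∧
    (∃ β : ℝ,
      Tendsto (fun α : ℝ => (1 - α) * discountedValue p q C lam α 0) (𝓝[<] 1) (𝓝 β) ∧
      SolvesAverageCostDP p q C lam (averageCostValue p q C lam) β) ∧
    (∀ x y z : ℕ, 0 < z → y < x →
      averageCostValue p q C lam (y + z) - averageCostValue p q C lam y ≤
        averageCostValue p q C lam (x + z) - averageCostValue p q C lam x) := by
  obtain ⟨K, V, β, hsol, hV, hβ⟩ :=
    exists_isAverageSolution_tendsto hp.le hpq hq.le hC.le lam
  have hlim : averageCostValue p q C lam = V := funext fun x => (hV x).limUnder_eq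
  rw [hlim]
  refine ⟨hV, ⟨β, hβ, (solvesAverageCostDP_iff p q C lam V β).2 hsol.eq⟩, fun x y z _ hyx => ?_⟩
  have hconv : IncreasingConvex V := by
    refine .of_tendsto (l := 𝓝[<] (1 : ℝ)) ?_ hV
    filter_upwards [eventually_nhdsWithin_of_eventually_nhds (eventually_ge_nhds zero_lt_one),
      self_mem_nhdsWithin] with α hα₀ hα
    have h := (discountedValue_spec (lam := lam) hp.le (by linarith) (by linarith) hq.le hC.le
      hα₀ hα).2.1
    refine ⟨fun a b hab => sub_le_sub_right (h.monotone hab) _, fun a b hab => ?_⟩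
    simpa [fwdDiff, relativeValue] using h.fwdDiff_monotone hab
  exact hconv.sub_le_sub hyx.le z
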